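/- Let $\Sigma$ be a nonempty finite alphabet, $\Sigma_\downarrow=\Sigma\cup\{\downarrow\}$, and define the active window of a stream $u\in\Sigma_\downarrow^*$ by $\mathrm{wnd}(\varepsilon)=\varepsilon$, $\mathrm{wnd}(ua)=\mathrm{wnd}(u)a$ for $a\in\Sigma$, and $\mathrm{wnd}(u{\downarrow})=v$ if $\mathrm{wnd}(u)=av$ with $a\in\Sigma$, $\mathrm{wnd}(u{\downarrow})=\varepsilon$ if $\mathrm{wnd}(u)=\varepsilon$. Let $\mathrm{mwl}(u)$ be the maximum of $|\mathrm{wnd}(u')|$ over all prefixes $u'$ of $u$. A randomized variable-size sliding-window algorithm $\mathcal P$ for $L\subseteq\Sigma^*$ is a probabilistic automaton over $\Sigma_\downarrow$ (with an arbitrary, possibly infinite, nonempty state set $Q$, an initial distribution on $Q$, transition probabilities, and a set of final states) such that for every $u\in\Sigma_\downarrow^*$, after reading $u$, the state is final with probability at least $2/3$ if $\mathrm{wnd}(u)\in L$, and non-final with probability at least $2/3$ if $\mathrm{wnd}(u)\notin L$. Its space complexity is $v(\mathcal P,n)=\log_2|M_{\le n}|\in\mathbb R_{\ge0}\cup\{\infty\}$,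 where $M_{\le n}$ is the set of states reached with nonzero probability on some stream $u$ with $\mathrm{mwl}(u)\le n$. A deterministic variable-size sliding-window algorithm for $L$ is a deterministic automaton (possibly with infinitely many states) that accepts exactly the streams $u$ with $\mathrm{wnd}(u)\in L$; $v(\mathcal P,n)$ is defined in the same way. (1) If $\emptyset\subsetneq L\subsetneq\Sigma^*$ is any language, then every randomized variable-size sliding-window algorithm $\mathcal P$ for $L$ satisfies $v(\mathcal P,n)=\Omega(\log n)$. (2) Randomized variable-size algorithms show the same space trichotomy as deterministic ones. Let $L\subseteq\Sigma^*$ be regular, and let $\langle\mathbf{LI},\mathbf{Len}\rangle$ be the class of finite Boolean combinations of regular left ideals $\Sigma^*K$ ($K\subseteq\Sigma^*$ regular) and regular length languages (regular $K$ such that for all $n$, $\Sigma^n\subseteq K$ or $\Sigma^n\cap K=\emptyset$). Then, both for randomized and for deterministic variable-size sliding-window algorithms: - if $L\in\{\emptyset,\Sigma^*\}$, then some algorithm for $L$ satisfies $v(\mathcal P,n)=O(1)$; - if $L\notin\{\emptyset,\Sigma^*\}$ and $L\in\langle\mathbf{LI},\mathbf{Len}\rangle$, then some algorithm for $L$ satisfies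 $v(\mathcal P,n)=O(\log n)$, and every algorithm for $L$ satisfies $v(\mathcal P,n)=\Omega(\log n)$; - if $L\notin\langle\mathbf{LI},\mathbf{Len}\rangle$, then some algorithm for $L$ satisfies $v(\mathcal P,n)=O(n)$, and every algorithm for $L$ satisfies $v(\mathcal P,n)=\Omega(n)$. In all lower bounds the constants hidden in $\Omega$ (factor and threshold) depend only on $L$, not on $\mathcal P$. -/

import Mathlib

open scoped ENNReal

universe u v

namespace SlidingWindow

noncomputable section

/-! ### The variable-size sliding window problem

A stream over the extended alphabet is a list over `Option α`: the letter `some a` appends `a` to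
the window, and `none` is the pop operation. -/

/-- One update of the active window. Popping the empty window leaves it empty. -/
def windowStep {α : Type u} (w : List α) : Option α → List α
  | some a => w ++ [a]
  | none => w.tail

/-- The active window after reading a stream. -/
def window {α : Type u} (x : List (Option α)) : List α :=
  x.foldl windowStep []

/-- The maximum length of the active window, over all prefixes of the stream. -/
def maxWindowLength {α : Type u} (x : List (Option α)) : ℕ :=
  (Finset.range (x.length + 1)).sup fun i => (window (x.take i)).length

/-- The variable-size sliding window problem of `L`: all streams whose active window is in `L`. -/
def SW {α : Type u} (L : Language α) : Language (Option α) :=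
  {x : List (Option α) | window x ∈ L}

/-! ### Streaming algorithms -/

/-- A randomized streaming algorithm (probabilistic automaton) over the alphabet `β`, with a
possibly infinite set `Q` of memory states. -/
structure RandAlg (β : Type u) (Q : Type v) where
  /-- The initial state distribution. -/
  init : PMF Q
  /-- The transition probabilities. -/
  step : Q → β → PMF Q
  /-- The final states. -/
  accept : Set Q

/-- The distribution of the memory state after reading a word. -/
def RandAlg.run {β : Type u} {Q : Type v} (P : RandAlg β Q) (x : List β) : PMF Q :=
  x.foldl (fun μ b => μ.bind fun q => P.step q b) P.init

/-- `P` is a randomized streaming algorithm for the language `K` with two-sided error `err`. -/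
def RandAlg.IsFor {β : Type u} {Q : Type v} (P : RandAlg β Q) (K : Language β) (err : ℝ≥0∞) :
    Prop :=
  (∀ x ∈ K, 1 - err ≤ (P.run x).toOuterMeasure P.accept) ∧
    (∀ x ∉ K, 1 - err ≤ (P.run x).toOuterMeasure P.acceptᶜ)

/-- A randomized variable-size sliding window algorithm for `L` (with error `1/3`). -/
def IsRandSWAlg {α : Type u} {Q : Type v} (P : RandAlg (Option α) Q) (L : Language α) : Prop :=
  P.IsFor (SW L) (1 / 3)

/-- A deterministic variable-size sliding window algorithm for `L`. Mathlib's `DFA` does not ask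
for finitely many states, so it is a deterministic streaming algorithm. -/
def IsDetSWAlg {α : Type u} {Q : Type v} (P : DFA (Option α) Q) (L : Language α) : Prop :=
  P.accepts = SW L

/-! ### Space complexity -/

/-- The number `log₂ |S|` of bits needed for storing an element of `S`; infinite if `S` is. -/
def bits {Q : Type v} (S : Set Q) : ℝ≥0∞ :=
  open Classical in
  if S.Finite then ENNReal.ofReal (Real.logb 2 S.ncard) else ⊤

/-- The space complexity `v(P, n)` of a randomized algorithm: the number of bits needed for the
memory states that are reached with nonzero probability on some stream whose window length never
exceeds `n`. -/
def randSpace {α : Type u} {Q : Type v} (P : RandAlg (Option α) Q) (n : ℕ) : ℝ≥0∞ :=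
  bits {q : Q | ∃ x : List (Option α), maxWindowLength x ≤ n ∧ q ∈ (P.run x).support}

/-- The space complexity `v(P, n)` of a deterministic algorithm. -/
def detSpace {α : Type u} {Q : Type v} (P : DFA (Option α) Q) (n : ℕ) : ℝ≥0∞ :=
  bits {q : Q | ∃ x : List (Option α), maxWindowLength x ≤ n ∧ q = P.eval x}

/-- `f = O(g)`. -/
def IsBigO (f : ℕ → ℝ≥0∞) (g : ℕ → ℝ) : Prop :=
  ∃ C : ℝ, 0 < C ∧ ∃ n₀ : ℕ, ∀ n ≥ n₀, f n ≤ ENNReal.ofReal (C * g n)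

/-- Some randomized variable-size sliding window algorithm for `L` uses `O(g)` bits. -/
def RandUpper {α : Type u} (L : Language α) (g : ℕ → ℝ) : Prop :=
  ∃ (Q : Type u) (P : RandAlg (Option α) Q), IsRandSWAlg P L ∧ IsBigO (randSpace P) g

/-- Every randomized variable-size sliding window algorithm for `L` uses `Ω(g)` bits,
where the constants in `Ω` depend only on `L`. -/
def RandLower {α : Type u} (L : Language α) (g : ℕ → ℝ) : Prop :=
  ∃ c : ℝ, 0 < c ∧ ∃ n₀ : ℕ, ∀ (Q : Type v) (P : RandAlg (Option α) Q), IsRandSWAlg P L →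
    ∀ n ≥ n₀, ENNReal.ofReal (c * g n) ≤ randSpace P n

/-- Some deterministic variable-size sliding window algorithm for `L` uses `O(g)` bits. -/
def DetUpper {α : Type u} (L : Language α) (g : ℕ → ℝ) : Prop :=
  ∃ (Q : Type u) (P : DFA (Option α) Q), IsDetSWAlg P L ∧ IsBigO (detSpace P) g

/-- Every deterministic variable-size sliding window algorithm for `L` uses `Ω(g)` bits,
where the constants in `Ω` depend only on `L`. -/
def DetLower {α : Type u} (L : Language α) (g : ℕ → ℝ) : Prop :=
  ∃ c : ℝ, 0 < c ∧ ∃ n₀ : ℕ, ∀ (Q : Type v) (P : DFA (Option α) Q), IsDetSWAlg P L →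
    ∀ n ≥ n₀, ENNReal.ofReal (c * g n) ≤ detSpace P n

/-! ### Classes of regular languages -/

/-- The regular left ideals `Σ* K` with `K` regular. -/
def LI (α : Type u) : Set (Language α) :=
  {L | ∃ K : Language α, K.IsRegular ∧ L = ⊤ * K}

/-- The regular length languages: each `Σⁿ` is contained in the language or disjoint from it. -/
def Len (α : Type u) : Set (Language α) :=
  {L | L.IsRegular ∧ ∀ n : ℕ, (∀ w : List α, w.length = n → w ∈ L) ∨
    (∀ w : List α, w.length = n → w ∉ L)}

/-- The finite Boolean combinations of regular left ideals and regular length languages. -/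
def LILen (α : Type u) : Set (Language α) :=
  BooleanSubalgebra.closure (LI α ∪ Len α)

end

end SlidingWindow

/-! Lower bounds. Let a set of streams be shattered to depth `d` by continuations: an adversary can
fix the answers to `d` adaptive tests one by one, and some stream in the set realizes them. Give
every memory state weight 1 and, after each test, multiply its weight by `2 ^ s`, where `s` is its
probability of giving the adversary's answer. Since `2 ^ a + 2 ^ (1 - a) ≤ 3`, the adversary can
choose answers that multiply the total by at most `3 / 2` each time. For the resulting stream,
correctness forces some state to have total score at least `2 * d / 3`. As `log₂ (3 / 2) < 2 / 3`,
the number of states is exponential in `d` (`Shatters.pow_le_card`), with no amplification of the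
success probability. A deterministic algorithm is a special randomized one.

A nontrivial `L` shatters the runs `aʲ` with `j ≤ n` to depth about `log₃ n` (`shatters_replicate`).
For linear depth, take an automaton for the reversal of `L`, which reads the window from its newest
letter. Suppose an accepting state `p` has a loop `u`, and a word `v` of equal length leads from `p`
to a rejecting state from which `v'` returns to `p`. Then a window made of blocks `u v v'` and `v v'
u` stores arbitrary bits, and popping down to a prefix of one block reads a bit off
(`shatters_blockStreams`). If there is no such configuration, `L` is an explicit Boolean combination
of left ideals and length languages (`mem_LILen_of_wellBehaved`).

Upper bounds. It suffices to bound the number of values of a statistic of the window that decides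
`L` and can be updated. The window itself gives linear space. Length languages need only the length;
a left ideal needs boundedly many positions in the window (`hasPolynomialInvariant_of_mem_LI`).
Pairing statistics handles Boolean combinations. -/

namespace SlidingWindow

/-! ### Adaptive shattering and a lower bound for one-way communication -/

/-- `X` is shattered to depth `d` by continuations: there is a complete binary tree of depth `d`
whose inner nodes carry a continuation, and each of whose branches is realized by an element of
`X`. This is the Littlestone dimension of the words in `X` as tested by `K`. -/
def Shatters {β : Type u} (K : Language β) : ℕ → Set (List β) → Prop
  | 0, X => X.Nonempty
  | d + 1, X => ∃ y, Shatters K d {x ∈ X | x ++ y ∈ K} ∧ Shatters K d {x ∈ X | x ++ y ∉ K}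

theorem Shatters.mono {β : Type u} {K : Language β} {d : ℕ} {X Y : Set (List β)}
    (h : Shatters K d X) (hXY : X ⊆ Y) : Shatters K d Y := by
  induction d generalizing X Y with
  | zero => exact Set.Nonempty.mono hXY h
  | succ d ih =>
    obtain ⟨y, h1, h0⟩ := h
    exact ⟨y, ih h1 fun x hx => ⟨hXY hx.1, hx.2⟩, ih h0 fun x hx => ⟨hXY hx.1, hx.2⟩⟩

/-- The probability `a` of acceptance, or of rejection, whichever is correct for `z`. -/
noncomputable def score {β : Type u} (K : Language β) (z : List β) (a : ℝ) : ℝ :=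
  open Classical in if z ∈ K then a else 1 - a

/-- By convexity `2 ^ a` lies below its chord `1 + a` on the unit interval. -/
theorem two_rpow_add_two_rpow_le {a : ℝ} (h0 : 0 ≤ a) (h1 : a ≤ 1) :
    (2 : ℝ) ^ a + 2 ^ (1 - a) ≤ 3 := by
  have h := rpow_one_add_le_one_add_mul_self (s := 1) (by norm_num) h0 h1
  have h' := rpow_one_add_le_one_add_mul_self (s := 1) (p := 1 - a) (by norm_num)
    (by linarith) (by linarith)
  norm_num at h h'
  linarith

/-- An adversary that at each test keeps the answer for which the weight grows least. -/
theorem Shatters.exists_sum_le {β : Type u} {Q : Type v} {K : Language β} (S : Finset Q)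
    (a : Q → List β → ℝ) (h0 : ∀ q y, 0 ≤ a q y) (h1 : ∀ q y, a q y ≤ 1) {d : ℕ}
    {X : Set (List β)} (h : Shatters K d X) (w : Q → ℝ) (hw : ∀ q, 0 ≤ w q) :
    ∃ x ∈ X, ∃ ys : List (List β), ys.length = d ∧
      ∑ q ∈ S, w q * 2 ^ (ys.map fun y => score K (x ++ y) (a q y)).sum
        ≤ (3 / 2) ^ d * ∑ q ∈ S, w q := by
  induction d generalizing X w with
  | zero =>
    obtain ⟨x, hx⟩ := h
    exact ⟨x, hx, [], rfl, by simp⟩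
  | succ d ih =>
    obtain ⟨y, hacc, hrej⟩ := h
    have hsum : ∑ q ∈ S, w q * 2 ^ a q y + ∑ q ∈ S, w q * 2 ^ (1 - a q y)
        ≤ 3 * ∑ q ∈ S, w q := by
      rw [← Finset.sum_add_distrib, Finset.mul_sum]
      refine Finset.sum_le_sum fun q _ => ?_
      have := mul_le_mul_of_nonneg_left (two_rpow_add_two_rpow_le (h0 q y) (h1 q y)) (hw q)
      linarith
    -- Both branches at once: `g` is the score of the test `y`, namely `a q y` or `1 - a q y`, and
    -- the induction runs with the reweighted states.
    have step : ∀ (g : Q → ℝ) (x : List β) (ys : List (List β)),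
        (∀ q, score K (x ++ y) (a q y) = g q) → ys.length = d →
        ∑ q ∈ S, w q * 2 ^ g q ≤ 3 / 2 * ∑ q ∈ S, w q →
        ∑ q ∈ S, w q * 2 ^ g q * 2 ^ (ys.map fun y => score K (x ++ y) (a q y)).sum
          ≤ (3 / 2) ^ d * ∑ q ∈ S, w q * 2 ^ g q →
        (y :: ys).length = d + 1 ∧
          ∑ q ∈ S, w q * 2 ^ ((y :: ys).map fun y => score K (x ++ y) (a q y)).sum
            ≤ (3 / 2) ^ (d + 1) * ∑ q ∈ S, w q := by
      intro g x ys hg hys hle hih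
      refine ⟨by simp [hys], ?_⟩
      simp only [List.map_cons, List.sum_cons, hg, Real.rpow_add two_pos, ← mul_assoc]
      calc _ ≤ _ := hih
        _ ≤ (3 / 2) ^ d * (3 / 2 * ∑ q ∈ S, w q) := by gcongr
        _ = _ := by ring
    rcases le_total (∑ q ∈ S, w q * 2 ^ a q y) (∑ q ∈ S, w q * 2 ^ (1 - a q y)) with hle | hle
    · obtain ⟨x, hx, ys, hys, hih⟩ := ih hacc (fun q => w q * 2 ^ a q y)
        fun q => mul_nonneg (hw q) (by positivity)
      exact ⟨x, hx.1, y :: ys, step _ x ys (fun q => if_pos hx.2) hys (by linarith) hih⟩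
    · obtain ⟨x, hx, ys, hys, hih⟩ := ih hrej (fun q => w q * 2 ^ (1 - a q y))
        fun q => mul_nonneg (hw q) (by positivity)
      exact ⟨x, hx.1, y :: ys, step _ x ys (fun q => if_neg hx.2) hys (by linarith) hih⟩

/-- The distribution of the memory state after reading a word, starting in the state `q`. -/
noncomputable def RandAlg.runFrom {β : Type u} {Q : Type v} (P : RandAlg β Q) (q : Q)
    (x : List β) : PMF Q :=
  x.foldl (fun μ b => μ.bind fun q => P.step q b) (PMF.pure q)

/-- The Markov property: all tests `y` are run from the same state distribution after `x`, so the
scores of a fixed state can be added up over several tests. -/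
theorem RandAlg.run_append {β : Type u} {Q : Type v} (P : RandAlg β Q) (x y : List β) :
    P.run (x ++ y) = (P.run x).bind fun q => P.runFrom q y := by
  unfold RandAlg.run RandAlg.runFrom
  rw [List.foldl_append]
  generalize x.foldl (fun μ b => μ.bind fun q => P.step q b) P.init = μ
  induction y using List.reverseRecOn with
  | nil => simp
  | append_singleton y b ih => simp [List.foldl_append, ih, PMF.bind_bind]

theorem PMF_toOuterMeasure_le_one {Q : Type v} (μ : PMF Q) (A : Set Q) :
    μ.toOuterMeasure A ≤ 1 := by
  rw [PMF.toOuterMeasure_apply, ← μ.tsum_coe]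
  exact ENNReal.tsum_le_tsum fun q => Set.indicator_le_self _ _ _

theorem PMF_toOuterMeasure_compl {Q : Type v} (μ : PMF Q) (A : Set Q) :
    (μ.toOuterMeasure Aᶜ).toReal = 1 - (μ.toOuterMeasure A).toReal := by
  have h : μ.toOuterMeasure A + μ.toOuterMeasure Aᶜ = 1 := by
    simp only [PMF.toOuterMeasure_apply]
    rw [← ENNReal.tsum_add, ← μ.tsum_coe]
    exact tsum_congr fun q => Set.indicator_self_add_compl_apply A μ q
  have hA := (PMF_toOuterMeasure_le_one μ A).trans_lt ENNReal.one_lt_top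
  have hB := (PMF_toOuterMeasure_le_one μ Aᶜ).trans_lt ENNReal.one_lt_top
  have := congrArg ENNReal.toReal h
  rw [ENNReal.toReal_add hA.ne hB.ne, ENNReal.toReal_one] at this
  linarith

/-- The probability of acceptance after reading `y` from the state `q`. -/
noncomputable def RandAlg.acceptProb {β : Type u} {Q : Type v} (P : RandAlg β Q) (q : Q)
    (y : List β) : ℝ :=
  ((P.runFrom q y).toOuterMeasure P.accept).toReal

theorem RandAlg.two_thirds_le_sum_score {β : Type u} {Q : Type v} {P : RandAlg β Q}
    {K : Language β} (hP : P.IsFor K (1 / 3)) {S : Finset Q} {x : List β}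
    (hx : (P.run x).support ⊆ S) (y : List β) :
    2 / 3 ≤ ∑ q ∈ S, (P.run x q).toReal * score K (x ++ y) (P.acceptProb q y) := by
  have key : ∀ A : Set Q, 1 - 1 / 3 ≤ (P.run (x ++ y)).toOuterMeasure A →
      2 / 3 ≤ ∑ q ∈ S, (P.run x q).toReal * ((P.runFrom q y).toOuterMeasure A).toReal := by
    intro A hA
    rw [RandAlg.run_append, PMF.toOuterMeasure_bind_apply, tsum_eq_sum (s := S)] at hA
    · have h := ENNReal.toReal_mono ?_ hA
      · rw [ENNReal.toReal_sum, ENNReal.toReal_sub_of_le] at h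
        · simp only [ENNReal.toReal_mul] at h
          norm_num at h
          exact h
        · norm_num
        · simp
        · exact fun q _ => ENNReal.mul_ne_top (PMF.apply_ne_top _ _)
            ((PMF_toOuterMeasure_le_one _ A).trans_lt ENNReal.one_lt_top).ne
      · exact ENNReal.sum_ne_top.2 fun q _ => ENNReal.mul_ne_top (PMF.apply_ne_top _ _)
            ((PMF_toOuterMeasure_le_one _ A).trans_lt ENNReal.one_lt_top).ne
    · intro q hq
      have : P.run x q = 0 := by
        by_contra h
        exact hq (hx ((PMF.mem_support_iff _ _).2 h))
      simp [this]
  unfold score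
  split_ifs with h
  · exact key _ (hP.1 _ h)
  · simpa only [RandAlg.acceptProb, PMF_toOuterMeasure_compl] using key _ (hP.2 _ h)

theorem Shatters.pow_le_card {β : Type u} {Q : Type v} {P : RandAlg β Q} {K : Language β}
    (hP : P.IsFor K (1 / 3)) {S : Finset Q} {X : Set (List β)}
    (hX : ∀ x ∈ X, (P.run x).support ⊆ S) {d : ℕ} (h : Shatters K d X) :
    (32 / 27 : ℝ) ^ d ≤ (S.card : ℝ) ^ 3 := by
  obtain ⟨x, hx, ys, hys, hle⟩ := h.exists_sum_le S P.acceptProb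
    (fun _ _ => ENNReal.toReal_nonneg)
    (fun q y => ENNReal.toReal_le_of_le_ofReal zero_le_one
      (by simpa using PMF_toOuterMeasure_le_one (P.runFrom q y) P.accept))
    (fun _ => 1) fun _ => zero_le_one
  set g : Q → ℝ := fun q => (ys.map fun y => score K (x ++ y) (P.acceptProb q y)).sum with hg
  have hsum : 2 / 3 * (d : ℝ) ≤ ∑ q ∈ S, (P.run x q).toReal * g q := by
    rw [← hys, hg]
    clear hle hg hys
    induction ys with
    | nil => simp
    | cons y ys ih =>
      have := RandAlg.two_thirds_le_sum_score hP (hX x hx) y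
      simp only [List.length_cons, List.map_cons, List.sum_cons, mul_add, Finset.sum_add_distrib]
      push_cast
      linarith
  have hone : ∑ q ∈ S, (P.run x q).toReal ≤ 1 := by
    rw [← ENNReal.toReal_sum fun q _ => PMF.apply_ne_top _ _]
    refine ENNReal.toReal_le_of_le_ofReal zero_le_one ?_
    rw [ENNReal.ofReal_one, ← (P.run x).tsum_coe]
    exact ENNReal.sum_le_tsum S
  -- Some state does at least as well as the average over the distribution after `x`.
  obtain ⟨q, hq, hqg⟩ : ∃ q ∈ S, 2 / 3 * (d : ℝ) ≤ g q := by
    by_contra! hlt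
    obtain ⟨q₀, hq₀⟩ := (P.run x).support_nonempty
    have : ∑ q ∈ S, (P.run x q).toReal * g q
        < ∑ q ∈ S, (P.run x q).toReal * (2 / 3 * (d : ℝ)) := by
      refine Finset.sum_lt_sum
        (fun q hq => mul_le_mul_of_nonneg_left (hlt q hq).le ENNReal.toReal_nonneg)
        ⟨q₀, hX x hx hq₀, mul_lt_mul_of_pos_left (hlt q₀ (hX x hx hq₀)) ?_⟩
      exact ENNReal.toReal_pos hq₀ (PMF.apply_ne_top _ _)
    rw [← Finset.sum_mul] at this
    nlinarith [Nat.cast_nonneg (α := ℝ) d]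
  have hcard : (2 : ℝ) ^ (2 / 3 * (d : ℝ)) ≤ (3 / 2) ^ d * S.card := by
    calc (2 : ℝ) ^ (2 / 3 * (d : ℝ)) ≤ 2 ^ g q := by gcongr; norm_num
      _ ≤ ∑ q ∈ S, 1 * (2 : ℝ) ^ g q := by
        simp only [one_mul]
        exact Finset.single_le_sum (f := fun q => (2 : ℝ) ^ g q) (fun _ _ => by positivity) hq
      _ ≤ _ := by simpa using hle
  -- Cubing clears the exponent `2 / 3`; the base `32 / 27` is `4 / (3 / 2) ^ 3`.
  have hcube : ((2 : ℝ) ^ (2 / 3 * (d : ℝ))) ^ 3 = 4 ^ d := by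
    rw [← Real.rpow_natCast, ← Real.rpow_mul zero_le_two,
      show 2 / 3 * (d : ℝ) * (3 : ℕ) = 2 * d by push_cast; ring, Real.rpow_mul zero_le_two]
    norm_num
  have h4 : (4 : ℝ) ^ d ≤ (27 / 8) ^ d * (S.card : ℝ) ^ 3 := by
    calc (4 : ℝ) ^ d ≤ ((3 / 2) ^ d * S.card) ^ 3 := by rw [← hcube]; gcongr
      _ = _ := by rw [mul_pow, ← pow_mul, mul_comm d, pow_mul]; norm_num
  rw [show (32 / 27 : ℝ) = 4 / (27 / 8) by norm_num, div_pow, div_le_iff₀ (by positivity)]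
  linarith

/-! ### Windows -/

theorem window_append {α : Type u} (x y : List (Option α)) :
    window (x ++ y) = y.foldl windowStep (window x) :=
  List.foldl_append

theorem foldl_windowStep_map_some {α : Type u} (v w : List α) :
    (w.map some).foldl windowStep v = v ++ w := by
  induction w generalizing v with
  | nil => simp
  | cons a w ih => simp [ih, windowStep]

theorem foldl_windowStep_replicate_none {α : Type u} (v : List α) (k : ℕ) :
    (List.replicate k none).foldl windowStep v = v.drop k := by
  induction k generalizing v with
  | zero => simp
  | succ k ih => simp [List.replicate_succ, ih, windowStep, List.drop_tail]

theorem window_map_some {α : Type u} (w : List α) : window (w.map some) = w :=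
  foldl_windowStep_map_some [] w

theorem window_map_some_append_pops {α : Type u} (w : List α) (k : ℕ) (v : List α) :
    window (w.map some ++ (List.replicate k none ++ v.map some)) = w.drop k ++ v := by
  rw [window_append, window_map_some, List.foldl_append, foldl_windowStep_replicate_none,
    foldl_windowStep_map_some]

theorem maxWindowLength_map_some {α : Type u} (w : List α) :
    maxWindowLength (w.map some) ≤ w.length := by
  refine Finset.sup_le fun i _ => ?_
  rw [← List.map_take, window_map_some]
  simp

theorem length_window_le {α : Type u} (x : List (Option α)) :
    (window x).length ≤ maxWindowLength x := by
  have := Finset.le_sup (f := fun i => (window (x.take i)).length)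
    (Finset.self_mem_range_succ x.length)
  rwa [List.take_length] at this

/-! ### Lower bounds from shattering -/

theorem ofReal_le_randSpace_of_shatters {α : Type u} {Q : Type v} {L : Language α}
    {P : RandAlg (Option α) Q} (hP : IsRandSWAlg P L) {n d : ℕ} {X : Set (List (Option α))}
    (hX : ∀ x ∈ X, maxWindowLength x ≤ n) (h : Shatters (SW L) d X) :
    ENNReal.ofReal (Real.logb 2 (32 / 27) / 3 * d) ≤ randSpace P n := by
  unfold randSpace bits
  split_ifs with hS
  · refine ENNReal.ofReal_le_ofReal ?_
    have hle := h.pow_le_card hP (S := hS.toFinset)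
      fun x hx q hq => by simpa using ⟨x, hX x hx, hq⟩
    rw [← Set.ncard_eq_toFinset_card _ hS] at hle
    have hlog := Real.logb_le_logb_of_le (b := 2) one_lt_two (by positivity) hle
    rw [Real.logb_pow, Real.logb_pow] at hlog
    push_cast at hlog
    linarith
  · exact le_top

theorem randLower_of_shatters {α : Type u} {L : Language α} {g : ℕ → ℝ} {C : ℝ} (hC : 0 < C)
    {n₀ : ℕ} (h : ∀ n ≥ n₀, ∃ (d : ℕ) (X : Set (List (Option α))),
      (∀ x ∈ X, maxWindowLength x ≤ n) ∧ Shatters (SW L) d X ∧ g n ≤ C * d) :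
    RandLower.{u, v} L g := by
  have hlog : 0 < Real.logb 2 (32 / 27) := Real.logb_pos one_lt_two (by norm_num)
  refine ⟨Real.logb 2 (32 / 27) / 3 / C, by positivity, n₀, fun Q P hP n hn => ?_⟩
  obtain ⟨d, X, hX, hs, hg⟩ := h n hn
  refine le_trans (ENNReal.ofReal_le_ofReal ?_) (ofReal_le_randSpace_of_shatters hP hX hs)
  rw [div_mul_eq_mul_div, div_le_iff₀ hC, mul_assoc]
  exact mul_le_mul_of_nonneg_left (by linarith) (by positivity)

/-! ### Nontrivial languages need logarithmic space -/

/-- Otherwise prepending a letter never changes membership, and every word behaves like the empty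
one. -/
theorem exists_cons_mem_iff_notMem {α : Type u} {L : Language α} (hbot : L ≠ ⊥) (htop : L ≠ ⊤) :
    ∃ (a : α) (w : List α), a :: w ∈ L ↔ w ∉ L := by
  by_contra! h
  have hall : ∀ w : List α, w ∈ L ↔ [] ∈ L := by
    intro w
    induction w with
    | nil => rfl
    | cons a w ih => have := h a w; tauto
  by_cases hn : [] ∈ L
  · exact htop (Set.eq_univ_of_forall fun w => (hall w).2 hn)
  · exact hbot (Set.eq_empty_of_forall_notMem fun w hw => hn ((hall w).1 hw))

theorem exists_le_card_filter {D : Finset ℕ} {m k : ℕ} (h : m + k ≤ D.card) :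
    ∃ t, m ≤ {j ∈ D | j < t}.card ∧ k ≤ {j ∈ D | t ≤ j}.card := by
  induction m generalizing k with
  | zero => exact ⟨0, by simp, by simpa using h⟩
  | succ m ih =>
    obtain ⟨t, hlo, hhi⟩ := ih (k := k + 1) (by omega)
    have hne : {j ∈ D | t ≤ j}.Nonempty := Finset.card_pos.1 (by omega)
    obtain ⟨i, hi, hmin⟩ := Finset.exists_min_image _ id hne
    simp only [Finset.mem_filter, id] at hi hmin
    refine ⟨i + 1, ?_, ?_⟩
    · have hsub : insert i {j ∈ D | j < t} ⊆ {j ∈ D | j < i + 1} := by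
        intro j hj
        simp only [Finset.mem_insert, Finset.mem_filter] at hj ⊢
        rcases hj with rfl | hj
        · exact ⟨hi.1, by omega⟩
        · exact ⟨hj.1, by omega⟩
      have := Finset.card_le_card hsub
      rw [Finset.card_insert_of_notMem (by simp; omega)] at this
      omega
    · have hsub : {j ∈ D | t ≤ j}.erase i ⊆ {j ∈ D | i + 1 ≤ j} := by
        intro j hj
        simp only [Finset.mem_erase, Finset.mem_filter] at hj ⊢
        have := hmin j hj.2
        exact ⟨hj.2.1, by omega⟩
      have := Finset.card_le_card hsub
      rw [Finset.card_erase_of_mem (by simpa using hi)] at this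
      omega

/-- Runs of length at most `t` vanish after `t` pops. Popping `t` and pushing `w`, or popping `t +
1` and pushing `a :: w`, yields the same window on longer runs but opposite answers on short ones.
So whatever answer prevails on the long runs, one of the two tests separates them from the short
ones. -/
theorem shatters_replicate {α : Type u} {L : Language α} {a : α} {w : List α}
    (haw : a :: w ∈ L ↔ w ∉ L) (d : ℕ) (D : Finset ℕ) (hD : 3 ^ d ≤ D.card) :
    Shatters (SW L) d {x | ∃ j ∈ D, x = (List.replicate j a).map some} := by
  induction d generalizing D with
  | zero =>
    obtain ⟨j, hj⟩ := Finset.card_pos.1 (Nat.lt_of_lt_of_le (by simp) hD)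
    exact ⟨_, j, hj, rfl⟩
  | succ d ih =>
    have split : ∀ (y : List (Option α)) (D₁ D₀ : Finset ℕ), D₁ ⊆ D → D₀ ⊆ D →
        3 ^ d ≤ D₁.card → 3 ^ d ≤ D₀.card →
        (∀ j ∈ D₁, window ((List.replicate j a).map some ++ y) ∈ L) →
        (∀ j ∈ D₀, window ((List.replicate j a).map some ++ y) ∉ L) →
        Shatters (SW L) (d + 1) {x | ∃ j ∈ D, x = (List.replicate j a).map some} := by
      intro y D₁ D₀ h₁ h₀ hc₁ hc₀ hm₁ hm₀
      refine ⟨y, (ih D₁ hc₁).mono ?_, (ih D₀ hc₀).mono ?_⟩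
      · rintro _ ⟨j, hj, rfl⟩
        exact ⟨⟨j, h₁ hj, rfl⟩, hm₁ j hj⟩
      · rintro _ ⟨j, hj, rfl⟩
        exact ⟨⟨j, h₀ hj, rfl⟩, hm₀ j hj⟩
    -- A third of the runs are short; the other two thirds are long, so one of the two answers keeps
    -- a third of the whole.
    obtain ⟨t, hlo, hhi⟩ := exists_le_card_filter (D := D) (m := 3 ^ d) (k := 2 * 3 ^ d)
      (by rw [pow_succ] at hD; omega)
    have ht : t ≠ 0 := by
      rintro rfl
      simp at hlo
    obtain ⟨t, rfl⟩ : ∃ i, t = i + 1 := ⟨t - 1, by omega⟩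
    have hw : ∀ j, window ((List.replicate j a).map some ++
        (List.replicate t none ++ w.map some)) = List.replicate (j - t) a ++ w := by
      intro j
      rw [window_map_some_append_pops, List.drop_replicate]
    have hcons : ∀ j, window ((List.replicate j a).map some ++
        (List.replicate (t + 1) none ++ (a :: w).map some)) =
          List.replicate (j - (t + 1)) a ++ a :: w := by
      intro j
      rw [window_map_some_append_pops, List.drop_replicate]
    -- Two tests that agree on the runs longer than `t` and differ on all others.
    have hw_short : ∀ j ∈ {j ∈ D | j < t + 1}, window ((List.replicate j a).map some ++
        (List.replicate t none ++ w.map some)) = w := by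
      intro j hj
      rw [hw, Nat.sub_eq_zero_of_le (by simp at hj; omega)]
      rfl
    have hcons_short : ∀ j ∈ {j ∈ D | j < t + 1}, window ((List.replicate j a).map some ++
        (List.replicate (t + 1) none ++ (a :: w).map some)) = a :: w := by
      intro j hj
      rw [hcons, Nat.sub_eq_zero_of_le (by simp at hj; omega)]
      rfl
    have hcons_long : ∀ j ∈ {j ∈ D | t + 1 ≤ j}, window ((List.replicate j a).map some ++
        (List.replicate (t + 1) none ++ (a :: w).map some)) = List.replicate (j - t) a ++ w := by
      intro j hj
      obtain ⟨i, rfl⟩ := Nat.exists_eq_add_of_le (Finset.mem_filter.1 hj).2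
      rw [hcons, show t + 1 + i - (t + 1) = i by omega, show t + 1 + i - t = i + 1 by omega,
        List.replicate_succ', List.append_assoc]
      rfl
    classical
    have hcard := Finset.card_filter_add_card_filter_not (s := {j ∈ D | t + 1 ≤ j})
      (p := fun j => List.replicate (j - t) a ++ w ∈ L)
    rcases le_total (3 ^ d)
      {j ∈ {j ∈ D | t + 1 ≤ j} | List.replicate (j - t) a ++ w ∈ L}.card with hc | hc
    · have hsub := (Finset.filter_subset (fun j => List.replicate (j - t) a ++ w ∈ L)
        {j ∈ D | t + 1 ≤ j}).trans (Finset.filter_subset _ _)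
      by_cases hwL : w ∈ L
      · refine split (List.replicate (t + 1) none ++ (a :: w).map some) _ _
          hsub (Finset.filter_subset _ _) hc hlo
          (fun j hj => ?_) fun j hj => ?_
        · rw [hcons_long j (Finset.filter_subset _ _ hj)]
          exact (Finset.mem_filter.1 hj).2
        · rw [hcons_short j hj, haw, not_not]
          exact hwL
      · refine split (List.replicate t none ++ w.map some) _ _
          hsub (Finset.filter_subset _ _) hc hlo
          (fun j hj => ?_) fun j hj => ?_
        · rw [hw]
          exact (Finset.mem_filter.1 hj).2
        · rwa [hw_short j hj]
    · have hsub := (Finset.filter_subset (fun j => List.replicate (j - t) a ++ w ∉ L)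
        {j ∈ D | t + 1 ≤ j}).trans (Finset.filter_subset _ _)
      replace hc : 3 ^ d ≤
        {j ∈ {j ∈ D | t + 1 ≤ j} | List.replicate (j - t) a ++ w ∉ L}.card := by omega
      by_cases hwL : w ∈ L
      · refine split (List.replicate t none ++ w.map some) _ _
          (Finset.filter_subset _ _) hsub hlo hc
          (fun j hj => ?_) fun j hj => ?_
        · rwa [hw_short j hj]
        · rw [hw]
          exact (Finset.mem_filter.1 hj).2
      · refine split (List.replicate (t + 1) none ++ (a :: w).map some) _ _
          (Finset.filter_subset _ _) hsub hlo hc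
          (fun j hj => ?_) fun j hj => ?_
        · rwa [hcons_short j hj, haw]
        · rw [hcons_long j (Finset.filter_subset _ _ hj)]
          exact (Finset.mem_filter.1 hj).2

theorem randLower_logb {α : Type u} {L : Language α} (hbot : L ≠ ⊥) (htop : L ≠ ⊤) :
    RandLower.{u, v} L (fun n => Real.logb 2 n) := by
  obtain ⟨a, w, haw⟩ := exists_cons_mem_iff_notMem hbot htop
  -- With `k = Nat.log 3 (n + 1) ≥ 1`, `n ≤ 4 ^ (k + 1)` gives `log₂ n ≤ 2 * (k + 1) ≤ 4 * k`.
  refine randLower_of_shatters (C := 4) (by norm_num) (n₀ := 2) fun n hn =>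
    ⟨Nat.log 3 (n + 1), _, ?_, shatters_replicate haw _ (Finset.range (n + 1)) ?_, ?_⟩
  · rintro _ ⟨j, hj, rfl⟩
    have := maxWindowLength_map_some (List.replicate j a)
    simp at this hj
    simp
    omega
  · simpa using Nat.pow_log_le_self 3 (Nat.succ_ne_zero n)
  · have h1 : 1 ≤ Nat.log 3 (n + 1) := Nat.log_pos (by norm_num) (by omega)
    have h2 : n ≤ 4 ^ (Nat.log 3 (n + 1) + 1) := by
      have := Nat.lt_pow_succ_log_self (b := 3) (by norm_num) (n + 1)
      have := Nat.pow_le_pow_left (show 3 ≤ 4 by norm_num) (Nat.log 3 (n + 1) + 1)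
      simp only [Nat.succ_eq_add_one] at *
      omega
    have h3 : Real.logb 2 n ≤ Real.logb 2 ((2 ^ 2 : ℝ) ^ (Nat.log 3 (n + 1) + 1)) := by
      refine Real.logb_le_logb_of_le one_lt_two (by positivity) ?_
      norm_num
      exact_mod_cast h2
    rw [← pow_mul, Real.logb_pow, Real.logb_self_eq_one one_lt_two] at h3
    have : (1 : ℝ) ≤ Nat.log 3 (n + 1) := by exact_mod_cast h1
    push_cast at h3
    linarith

/-! ### Linear lower bound -/

/-- The streams that push the reversal of `c` followed by `k` blocks, each `x` or `y`. -/
def blockStreams {α : Type u} (x y c : List α) (k : ℕ) : Set (List (Option α)) :=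
  {s | ∃ l : List (List α), l.length = k ∧ (∀ b ∈ l, b = x ∨ b = y) ∧
    s = (c ++ l.flatten).reverse.map some}

theorem length_flatten_of_forall {α : Type u} {l : List (List α)} {r : ℕ}
    (h : ∀ b ∈ l, b.length = r) : l.flatten.length = l.length * r := by
  induction l with
  | nil => simp
  | cons b l ih => simp [ih fun b hb => h b (by simp [hb]), h b (by simp)]; ring

theorem blockStreams_append_subset {α : Type u} (x y c : List α) {b : List α}
    (hb : b = x ∨ b = y) (k : ℕ) : blockStreams x y (c ++ b) k ⊆ blockStreams x y c (k + 1) := by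
  rintro _ ⟨l, hl, hlb, rfl⟩
  refine ⟨b :: l, by simp [hl], ?_, by simp⟩
  rintro b' hb'
  rcases List.mem_cons.1 hb' with rfl | h
  exacts [hb, hlb _ h]

theorem window_blockStreams {α : Type u} {x y c b : List α} (hxy : x.length = y.length) {k : ℕ}
    {s : List (Option α)} (hs : s ∈ blockStreams x y (c ++ b) k) :
    window (s ++ List.replicate (k * x.length) none) = (c ++ b).reverse := by
  obtain ⟨l, hl, hlb, rfl⟩ := hs
  have := window_map_some_append_pops (c ++ b ++ l.flatten).reverse (k * x.length) []
  simp only [List.map_nil, List.append_nil] at this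
  have hlen := length_flatten_of_forall (l := l) (r := x.length)
    fun b hb => by rcases hlb b hb with rfl | rfl <;> simp [hxy]
  rw [this, List.reverse_append, List.drop_append_of_le_length (by simp [hlen, hl]),
    List.drop_eq_nil_of_le (by simp [hlen, hl]), List.nil_append]

/-- Both blocks are loops at `p` of the same length, so the state before each block is `p` whatever
the earlier choices. Pops remove the far end of the reversed window; what remains of the first block
after `c` is `u` or `v`, and these are told apart by acceptance. Then that block joins `c`. -/
theorem shatters_blockStreams {α : Type u} {σ : Type} {L : Language α} {M : DFA α σ}
    (hM : M.accepts = L.reverse) {p : σ} (hp : p ∈ M.accept) {u v v' : List α}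
    (huv : u.length = v.length) (hu : M.evalFrom p u = p) (hv : M.evalFrom p v ∉ M.accept)
    (hv' : M.evalFrom p (v ++ v') = p) (k : ℕ) (c : List α) (hc : M.eval c = p) :
    Shatters (SW L) k (blockStreams (u ++ (v ++ v')) (v ++ v' ++ u) c k) := by
  have hlen : (u ++ (v ++ v')).length = (v ++ v' ++ u).length := by simp; omega
  have hmem : ∀ w : List α, w.reverse ∈ L ↔ M.eval w ∈ M.accept := by
    intro w
    rw [← DFA.mem_accepts, hM, Language.mem_reverse]
  induction k generalizing c with
  | zero => exact ⟨_, [], rfl, by simp, rfl⟩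
  | succ k ih =>
    have heval : ∀ w, M.eval (c ++ w) = M.evalFrom p w := by
      intro w
      rw [← hc]
      exact M.evalFrom_of_append M.start c w
    have test : ∀ (b e : List α) (s : List (Option α)), e.length = (v ++ v').length →
        s ∈ blockStreams (u ++ (v ++ v')) (v ++ v' ++ u) (c ++ (b ++ e)) k →
        window (s ++ (List.replicate (k * (u ++ (v ++ v')).length) none ++
          List.replicate (v ++ v').length none)) = (c ++ b).reverse := by
      intro b e s he hs
      rw [← List.append_assoc, window_append, window_blockStreams hlen hs,
        foldl_windowStep_replicate_none, ← List.append_assoc, List.reverse_append,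
        List.drop_append_of_le_length (by simp [he]), List.drop_eq_nil_of_le (by simp [he]),
        List.nil_append]
    refine ⟨List.replicate (k * (u ++ (v ++ v')).length) none ++
      List.replicate (v ++ v').length none,
      (ih (c ++ (u ++ (v ++ v'))) ?_).mono fun s hs => ⟨?_, ?_⟩,
      (ih (c ++ (v ++ (v' ++ u))) ?_).mono fun s hs => ⟨?_, ?_⟩⟩
    · rw [heval, DFA.evalFrom_of_append, hu, hv']
    · exact blockStreams_append_subset _ _ _ (Or.inl rfl) _ hs
    · change window _ ∈ L
      rw [test u (v ++ v') s rfl hs, hmem, heval, hu]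
      exact hp
    · rw [heval, ← List.append_assoc, DFA.evalFrom_of_append, hv', hu]
    · exact blockStreams_append_subset _ _ _ (Or.inr (by simp)) _ hs
    · change window _ ∉ L
      rw [test v (v' ++ u) s (by simp; omega) hs, hmem, heval]
      exact hv

/-- If the automaton `M` for the reversal of `L` has an accepting state with a loop, and a word
of the same length that leads to a rejecting state of the same strongly connected component,
then `L` needs linear space. -/
theorem randLower_linear {α : Type u} {σ : Type} {L : Language α} {M : DFA α σ}
    (hM : M.accepts = L.reverse) {z u v v' : List α} (hp : M.eval z ∈ M.accept)
    (huv : u.length = v.length) (hu : M.evalFrom (M.eval z) u = M.eval z)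
    (hv : M.evalFrom (M.eval z) v ∉ M.accept)
    (hv' : M.evalFrom (M.eval z) (v ++ v') = M.eval z) :
    RandLower.{u, v} L (fun n => n) := by
  have hlen : (u ++ (v ++ v')).length = (v ++ v' ++ u).length := by simp; omega
  obtain ⟨r, hr⟩ : ∃ r, r = (u ++ (v ++ v')).length := ⟨_, rfl⟩
  have hrpos : 0 < r := by
    rcases v with _ | ⟨a, v⟩
    · exact absurd hp hv
    · simp at hr; omega
  -- The threshold makes room for one block, so the number `k` of blocks is at least 1 and `n ≤
  -- z.length + r * (k + 1) ≤ (z.length + 2 * r) * k`.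
  refine randLower_of_shatters (C := z.length + 2 * r) (by positivity) (n₀ := z.length + r)
    fun n hn => ⟨(n - z.length) / r, _, ?_,
      shatters_blockStreams hM hp huv hu hv hv' _ z rfl, ?_⟩
  · rintro _ ⟨l, hl, hlb, rfl⟩
    refine (maxWindowLength_map_some _).trans ?_
    have := length_flatten_of_forall (l := l) (r := r)
      fun b hb => by rcases hlb b hb with rfl | rfl <;> simp [hr, hlen]
    rw [List.length_reverse, List.length_append, this, hl]
    have := Nat.div_mul_le_self (n - z.length) r
    omega
  · have h1 : 1 ≤ (n - z.length) / r := (Nat.one_le_div_iff hrpos).2 (by omega)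
    have h2 : n ≤ z.length + r * ((n - z.length) / r + 1) := by
      have := Nat.lt_mul_div_succ (n - z.length) hrpos
      omega
    have h3 : n ≤ (z.length + 2 * r) * ((n - z.length) / r) := by nlinarith
    exact_mod_cast h3

/-! ### Deterministic algorithms are randomized algorithms -/

/-- A deterministic algorithm, seen as a randomized one. -/
noncomputable def toRandAlg {β : Type u} {Q : Type v} (P : DFA β Q) : RandAlg β Q where
  init := PMF.pure P.start
  step q b := PMF.pure (P.step q b)
  accept := P.accept

theorem toRandAlg_run {β : Type u} {Q : Type v} (P : DFA β Q) (x : List β) :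
    (toRandAlg P).run x = PMF.pure (P.eval x) := by
  induction x using List.reverseRecOn with
  | nil => rfl
  | append_singleton x b ih =>
    unfold RandAlg.run at ih ⊢
    rw [List.foldl_append, ih, DFA.eval_append_singleton]
    exact PMF.pure_bind _ _

theorem IsDetSWAlg.isRandSWAlg {α : Type u} {Q : Type v} {P : DFA (Option α) Q} {L : Language α}
    (hP : IsDetSWAlg P L) : IsRandSWAlg (toRandAlg P) L := by
  have hP' : ∀ x, x ∈ SW L ↔ P.eval x ∈ P.accept := fun x => by rw [← hP, DFA.mem_accepts]
  constructor
  · intro x hx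
    have : (toRandAlg P).accept = P.accept := rfl
    simp [toRandAlg_run, PMF.toOuterMeasure_pure_apply, this, (hP' x).1 hx]
  · intro x hx
    have : (toRandAlg P).accept = P.accept := rfl
    simp [toRandAlg_run, PMF.toOuterMeasure_pure_apply, this, mt (hP' x).2 hx]

theorem randSpace_toRandAlg {α : Type u} {Q : Type v} (P : DFA (Option α) Q) :
    randSpace (toRandAlg P) = detSpace P := by
  funext n
  simp [randSpace, detSpace, toRandAlg_run]

theorem RandLower.detLower {α : Type u} {L : Language α} {g : ℕ → ℝ}
    (h : RandLower.{u, v} L g) : DetLower.{u, v} L g := by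
  obtain ⟨c, hc, n₀, h⟩ := h
  refine ⟨c, hc, n₀, fun Q P hP n hn => ?_⟩
  rw [← randSpace_toRandAlg]
  exact h Q _ hP.isRandSWAlg n hn

theorem DetUpper.randUpper {α : Type u} {L : Language α} {g : ℕ → ℝ} (h : DetUpper L g) :
    RandUpper L g := by
  obtain ⟨Q, P, hP, hO⟩ := h
  exact ⟨Q, toRandAlg P, hP.isRandSWAlg, by rwa [randSpace_toRandAlg]⟩

/-! ### Upper bounds from invariants of the window -/

/-- `φ` retains enough of the window to decide `L` and to be updated. -/
def IsWindowInvariant {α : Type u} {T : Type v} (L : Language α) (φ : List α → T) : Prop :=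
  (∀ w w', φ w = φ w' → (w ∈ L ↔ w' ∈ L)) ∧
    ∀ w w' b, φ w = φ w' → φ (windowStep w b) = φ (windowStep w' b)

theorem IsWindowInvariant.foldl_mem_iff {α : Type u} {T : Type v} {L : Language α}
    {φ : List α → T} (h : IsWindowInvariant L φ) (y : List (Option α)) {w w' : List α}
    (hw : φ w = φ w') : y.foldl windowStep w ∈ L ↔ y.foldl windowStep w' ∈ L := by
  induction y generalizing w w' with
  | nil => exact h.1 _ _ hw
  | cons b y ih => exact ih (h.2 _ _ b hw)

theorem bits_le {Q : Type v} {S : Set Q} {N : ℕ} (hS : S.Finite) (hN : S.ncard ≤ N) :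
    bits S ≤ ENNReal.ofReal (Real.logb 2 N) := by
  unfold bits
  rw [if_pos hS]
  refine ENNReal.ofReal_le_ofReal ?_
  rcases Nat.eq_zero_or_pos S.ncard with h | h
  · rw [h, Nat.cast_zero, Real.logb_zero]
    exact div_nonneg (Real.log_natCast_nonneg _) (Real.log_nonneg one_le_two)
  · exact Real.logb_le_logb_of_le one_lt_two (by exact_mod_cast h) (by exact_mod_cast hN)

theorem coe_eval_toDFA {β : Type u} (K : Language β) (x : List β) :
    (K.toDFA.eval x : Language β) = K.leftQuotient x := by
  induction x using List.reverseRecOn with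
  | nil => rfl
  | append_singleton x b ih =>
    rw [DFA.eval_append_singleton, Language.step_toDFA, ih, Language.leftQuotient_append]

/-- The algorithm is the minimal automaton of `SW L`. Streams whose windows share a value of `φ`
have the same left quotient, so its states are counted by values of `φ`. -/
theorem IsWindowInvariant.detUpper {α : Type u} {T : Type v} {L : Language α}
    {φ : List α → T} (h : IsWindowInvariant L φ) {N : ℕ → ℕ}
    (hN : ∀ n, (φ '' {w | w.length ≤ n}).Finite ∧ (φ '' {w | w.length ≤ n}).ncard ≤ N n)
    {g : ℕ → ℝ} {C : ℝ} (hC : 0 < C) {n₀ : ℕ} (hg : ∀ n ≥ n₀, Real.logb 2 (N n) ≤ C * g n) :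
    DetUpper L g := by
  refine ⟨_, (SW L).toDFA, (SW L).accepts_toDFA, C, hC, n₀, fun n hn => ?_⟩
  have hfac : Function.FactorsThrough (SW L).toDFA.eval fun x => φ (window x) := by
    intro x x' hx
    refine Subtype.ext ?_
    rw [coe_eval_toDFA, coe_eval_toDFA]
    ext y
    rw [Language.mem_leftQuotient, Language.mem_leftQuotient]
    change window _ ∈ L ↔ window _ ∈ L
    rw [window_append, window_append]
    exact h.foldl_mem_iff y hx
  have hsub : {q | ∃ x, maxWindowLength x ≤ n ∧ q = (SW L).toDFA.eval x} ⊆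
      Function.extend (fun x => φ (window x)) (SW L).toDFA.eval (fun _ => (SW L).toDFA.start) ''
        (φ '' {w | w.length ≤ n}) := by
    rintro _ ⟨x, hx, rfl⟩
    exact ⟨_, ⟨_, (length_window_le x).trans hx, rfl⟩, hfac.extend_apply _ x⟩
  have hfin := (hN n).1.image
    (Function.extend (fun x => φ (window x)) (SW L).toDFA.eval fun _ => (SW L).toDFA.start)
  refine (bits_le (hfin.subset hsub) ?_).trans (ENNReal.ofReal_le_ofReal (hg n hn))
  exact (Set.ncard_le_ncard hsub hfin).trans ((Set.ncard_image_le (hN n).1).trans (hN n).2)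

theorem detUpper_const {α : Type u} {L : Language α} (hL : L = ⊥ ∨ L = ⊤) :
    DetUpper L fun _ => 1 := by
  have h : IsWindowInvariant L fun _ : List α => () := by
    refine ⟨fun w w' _ => ?_, fun _ _ _ _ => rfl⟩
    rcases hL with rfl | rfl
    · exact iff_of_false id id
    · exact iff_of_true trivial trivial
  refine h.detUpper (N := fun _ => 1) (C := 1) (n₀ := 0) (fun n => ⟨Set.toFinite _, ?_⟩)
    one_pos (fun n _ => by simp)
  exact (Set.ncard_le_ncard (Set.subset_univ _)).trans (by simp)

theorem finite_and_ncard_le_of_subset_range {ι : Type u} {T : Type v} [Finite ι] {S : Set T}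
    {f : ι → T} {N : ℕ} (hS : S ⊆ Set.range f) (hN : Nat.card ι ≤ N) :
    S.Finite ∧ S.ncard ≤ N := by
  refine ⟨(Set.finite_range f).subset hS, (Set.ncard_le_ncard hS (Set.finite_range f)).trans ?_⟩
  rw [← Set.image_univ]
  exact (Set.ncard_image_le Set.finite_univ).trans (by rwa [Set.ncard_univ])

theorem detUpper_linear {α : Type u} [Finite α] [Nonempty α] (L : Language α) :
    DetUpper L fun n => n := by
  have h : IsWindowInvariant L (id : List α → List α) :=
    ⟨fun w w' hw => Eq.to_iff (congrArg (· ∈ L) hw),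
      fun w w' b hw => congrArg (fun w => windowStep w b) hw⟩
  have hα : (2 : ℝ) ≤ ((Nat.card α + 1 : ℕ) : ℝ) := by
    exact_mod_cast Nat.succ_le_succ (Nat.card_pos (α := α))
  refine h.detUpper (N := fun n => (Nat.card α + 1) ^ n)
    (C := Real.logb 2 ((Nat.card α + 1 : ℕ) : ℝ)) (n₀ := 0) (fun n => ?_)
    (Real.logb_pos one_lt_two (by linarith)) fun n _ => ?_
  · rw [Set.image_id]
    refine ⟨List.finite_length_le α n, ?_⟩
    -- Short words are padded with `none` to length `n`.
    have hinj : Set.InjOn (fun (w : List α) (i : Fin n) => w[(i : ℕ)]?) {w | w.length ≤ n} := by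
      intro w hw w' hw' h
      refine List.ext_getElem? fun i => ?_
      rcases lt_or_ge i n with hi | hi
      · exact congrFun h ⟨i, hi⟩
      · rw [List.getElem?_eq_none (le_trans hw hi), List.getElem?_eq_none (le_trans hw' hi)]
    refine (Set.ncard_le_ncard_of_injOn _ (fun _ _ => Set.mem_univ _) hinj).trans ?_
    rw [Set.ncard_univ, Nat.card_fun, Finite.card_option, Nat.card_fin]
  · push_cast
    rw [Real.logb_pow, mul_comm]

/-- `L` has a window invariant with polynomially many values. -/
def HasPolynomialInvariant {α : Type u} (L : Language α) : Prop :=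
  ∃ (T : Type u) (φ : List α → T), IsWindowInvariant L φ ∧ ∃ C : ℕ, ∀ n,
    (φ '' {w | w.length ≤ n}).Finite ∧ (φ '' {w | w.length ≤ n}).ncard ≤ (n + 2) ^ C

theorem HasPolynomialInvariant.detUpper {α : Type u} {L : Language α}
    (h : HasPolynomialInvariant L) : DetUpper L fun n => Real.logb 2 n := by
  obtain ⟨T, φ, hφ, C, hC⟩ := h
  refine hφ.detUpper hC (C := 2 * C + 1) (n₀ := 2) (by positivity) fun n hn => ?_
  have hn' : (2 : ℝ) ≤ n := by exact_mod_cast hn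
  have h1 : Real.logb 2 (n + 2) ≤ 2 * Real.logb 2 n := by
    rw [← Nat.cast_two (R := ℝ), ← Real.logb_pow]
    push_cast
    exact Real.logb_le_logb_of_le one_lt_two (by positivity) (by nlinarith)
  have h2 : 0 ≤ Real.logb 2 (n : ℝ) := Real.logb_nonneg one_lt_two (by linarith)
  push_cast
  rw [Real.logb_pow]
  nlinarith [Nat.cast_nonneg (α := ℝ) C]

theorem HasPolynomialInvariant.compl {α : Type u} {L : Language α}
    (h : HasPolynomialInvariant L) : HasPolynomialInvariant Lᶜ := by
  obtain ⟨T, φ, hφ, C, hC⟩ := h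
  exact ⟨T, φ, ⟨fun w w' hw => not_congr (hφ.1 w w' hw), hφ.2⟩, C, hC⟩

theorem HasPolynomialInvariant.sup {α : Type u} {L L' : Language α}
    (h : HasPolynomialInvariant L) (h' : HasPolynomialInvariant L') :
    HasPolynomialInvariant (L ⊔ L') := by
  obtain ⟨T, φ, hφ, C, hC⟩ := h
  obtain ⟨T', φ', hφ', C', hC'⟩ := h'
  refine ⟨T × T', fun w => (φ w, φ' w), ⟨fun w w' hw => ?_, fun w w' b hw => ?_⟩, C + C',
    fun n => ?_⟩
  · exact or_congr (hφ.1 _ _ (Prod.ext_iff.1 hw).1) (hφ'.1 _ _ (Prod.ext_iff.1 hw).2)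
  · exact Prod.ext (hφ.2 _ _ b (Prod.ext_iff.1 hw).1) (hφ'.2 _ _ b (Prod.ext_iff.1 hw).2)
  · have hsub : (fun w => (φ w, φ' w)) '' {w | w.length ≤ n} ⊆
        (φ '' {w | w.length ≤ n}) ×ˢ (φ' '' {w | w.length ≤ n}) := by
      rintro _ ⟨w, hw, rfl⟩
      exact ⟨⟨w, hw, rfl⟩, ⟨w, hw, rfl⟩⟩
    have hfin := (hC n).1.prod (hC' n).1
    refine ⟨hfin.subset hsub, (Set.ncard_le_ncard hsub hfin).trans ?_⟩
    rw [Set.ncard_prod, pow_add]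
    exact Nat.mul_le_mul (hC n).2 (hC' n).2

theorem hasPolynomialInvariant_of_mem_Len {α : Type u} {L : Language α} (hL : L ∈ Len α) :
    HasPolynomialInvariant L := by
  refine ⟨ULift ℕ, fun w => ⟨w.length⟩, ⟨fun w w' hw => ?_, fun w w' b hw => ?_⟩, 1, fun n => ?_⟩
  · have hw : w.length = w'.length := congrArg ULift.down hw
    rcases hL.2 w.length with h | h
    · exact iff_of_true (h w rfl) (h w' hw.symm)
    · exact iff_of_false (h w rfl) (h w' hw.symm)
  · have hw : w.length = w'.length := congrArg ULift.down hw
    cases b <;> simp [windowStep, hw]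
  · refine finite_and_ncard_le_of_subset_range (f := fun i : Fin (n + 1) => ULift.up (i : ℕ)) ?_ ?_
    · rintro _ ⟨w, hw, rfl⟩
      exact ⟨⟨w.length, Nat.lt_succ_of_le hw⟩, rfl⟩
    · simp

theorem mem_top_mul_iff {α : Type u} {K : Language α} {w : List α} :
    w ∈ (⊤ : Language α) * K ↔ ∃ s, s <:+ w ∧ s ∈ K := by
  rw [Language.mem_mul]
  constructor
  · rintro ⟨a, -, s, hs, rfl⟩
    exact ⟨s, List.suffix_append _ _, hs⟩
  · rintro ⟨s, ⟨a, rfl⟩, hs⟩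
    exact ⟨a, trivial, s, hs, rfl⟩

/-- For `y` outside the left ideal of the language `K` of `M`, membership of the word `v ++ y` in
that left ideal depends only on the set of states from which `M` accepts `y`. -/
theorem append_mem_top_mul_iff {α : Type u} {σ : Type} (M : DFA α σ) {y : List α}
    (hy : y ∉ (⊤ : Language α) * M.accepts) (v : List α) :
    v ++ y ∈ (⊤ : Language α) * M.accepts ↔
      ∃ s, s <:+ v ∧ M.eval s ∈ {q : σ | M.evalFrom q y ∈ M.accept} := by
  have key : ∀ s, M.eval s ∈ {q : σ | M.evalFrom q y ∈ M.accept} ↔ s ++ y ∈ M.accepts := by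
    intro s
    rw [DFA.mem_accepts]
    change M.evalFrom (M.evalFrom _ _) _ ∈ M.accept ↔ M.evalFrom _ _ ∈ M.accept
    rw [DFA.evalFrom_of_append]
  simp only [key]
  constructor
  · intro h
    obtain ⟨s, hs, hK⟩ := mem_top_mul_iff.1 h
    rcases List.suffix_or_suffix_of_suffix hs (List.suffix_append v y) with h | ⟨t, rfl⟩
    · exact absurd (mem_top_mul_iff.2 ⟨s, h, hK⟩) hy
    · obtain ⟨a, ha⟩ := hs
      rw [← List.append_assoc] at ha
      exact ⟨t, ⟨a, List.append_cancel_right ha⟩, hK⟩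
  · rintro ⟨s, ⟨a, rfl⟩, hK⟩
    exact mem_top_mul_iff.2 ⟨_, ⟨a, by simp⟩, hK⟩

/-- For every continuation `y`, the positions from which the window followed by `y` is in `L`. -/
def suffixProfile {α : Type u} (L : Language α) (w : List α) : ℕ × (List α → Set ℕ) :=
  (w.length, fun y => {j | w.drop j ++ y ∈ L})

/-- A pop shifts the positions by one; pushing `a` replaces the continuation `y` by `a :: y`. This
holds for every `L`; only the number of profiles depends on it. -/
theorem isWindowInvariant_suffixProfile {α : Type u} (L : Language α) :
    IsWindowInvariant L (suffixProfile L) := by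
  refine ⟨fun w w' hw => ?_, fun w w' b hw => ?_⟩
  · have := Set.ext_iff.1 (congrFun (Prod.ext_iff.1 hw).2 []) 0
    simpa [suffixProfile] using this
  · obtain ⟨hl, hs⟩ := Prod.ext_iff.1 hw
    replace hl : w.length = w'.length := hl
    replace hs : ∀ y j, w.drop j ++ y ∈ L ↔ w'.drop j ++ y ∈ L :=
      fun y j => Set.ext_iff.1 (congrFun hs y) j
    refine Prod.ext ?_ (funext fun y => Set.ext fun j => ?_)
    · cases b <;> simp [suffixProfile, windowStep, hl]
    · cases b with
      | none => simpa [suffixProfile, windowStep] using hs y (j + 1)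
      | some a =>
        change (w ++ [a]).drop j ++ y ∈ L ↔ (w' ++ [a]).drop j ++ y ∈ L
        rcases le_or_gt j w.length with hj | hj
        · rw [List.drop_append_of_le_length hj, List.drop_append_of_le_length (hl ▸ hj)]
          simpa using hs (a :: y) j
        · rw [List.drop_eq_nil_of_le (by simp; omega), List.drop_eq_nil_of_le (by simp; omega)]

/-- The first position of `w` from which on no suffix leads `M` into `t`. -/
noncomputable def lastPosition {α : Type u} {σ : Type} (M : DFA α σ) (w : List α) (t : Set σ) :
    ℕ :=
  sInf {j | j = w.length ∨ ∀ s, s <:+ w.drop j → M.eval s ∉ t}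

theorem lastPosition_le {α : Type u} {σ : Type} (M : DFA α σ) (w : List α) (t : Set σ) :
    lastPosition M w t ≤ w.length :=
  Nat.sInf_le (Or.inl rfl)

/-- Suffixes of `w.drop j` only get fewer as `j` grows, so the positions in question form an initial
segment. As `M.start ∉ t`, the default position `w.length`, where only the empty suffix is left,
also qualifies. -/
theorem lt_lastPosition_iff {α : Type u} {σ : Type} (M : DFA α σ) (w : List α) {t : Set σ}
    (ht : M.start ∉ t) {j : ℕ} :
    j < lastPosition M w t ↔ ∃ s, s <:+ w.drop j ∧ M.eval s ∈ t := by
  constructor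
  · intro hj
    have := Nat.notMem_of_lt_sInf hj
    simp only [Set.mem_ofPred_eq, not_or] at this
    simpa using this.2
  · rintro ⟨s, hs, hst⟩
    by_contra! hj
    have hsuf : s <:+ w.drop (lastPosition M w t) :=
      hs.trans (List.drop_suffix_drop_left w hj)
    rcases Nat.sInf_mem (s := {j | j = w.length ∨ ∀ s, s <:+ w.drop j → M.eval s ∉ t})
      ⟨_, Or.inl rfl⟩ with h | h
    · rw [lastPosition, h, List.drop_length, List.suffix_nil] at hsuf
      exact ht (by simpa [hsuf] using hst)
    · exact h s hsuf hst

/-- For `y` in the ideal every position works. For any other `y` the positions are those below a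
cutoff that depends only on the set of states accepting `y`. So a profile amounts to the length and
one cutoff for each of the finitely many sets of states. -/
theorem hasPolynomialInvariant_of_mem_LI {α : Type u} {L : Language α} (hL : L ∈ LI α) :
    HasPolynomialInvariant L := by
  obtain ⟨_, ⟨σ, _, M, rfl⟩, rfl⟩ := hL
  refine ⟨_, _, isWindowInvariant_suffixProfile _, 1 + Nat.card (Set σ), fun n => ?_⟩
  refine finite_and_ncard_le_of_subset_range
    (f := fun c : Fin (n + 1) × (Set σ → Fin (n + 1)) => (((c.1 : ℕ), fun y : List α =>
      {j : ℕ | y ∈ (⊤ : Language α) * M.accepts ∨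
        j < (c.2 {q : σ | M.evalFrom q y ∈ M.accept} : ℕ)}) : ℕ × (List α → Set ℕ))) ?_ ?_
  · rintro _ ⟨w, hw, rfl⟩
    have hw : w.length ≤ n := hw
    refine ⟨(⟨w.length, by omega⟩, fun t => ⟨lastPosition M w t, ?_⟩), Prod.ext rfl ?_⟩
    · exact Nat.lt_succ_of_le ((lastPosition_le M w t).trans hw)
    · refine funext fun y => Set.ext fun j => ?_
      change y ∈ (⊤ : Language α) * M.accepts ∨ j < lastPosition M w _ ↔
        w.drop j ++ y ∈ (⊤ : Language α) * M.accepts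
      by_cases hy : y ∈ (⊤ : Language α) * M.accepts
      · refine iff_of_true (Or.inl hy) ?_
        obtain ⟨s, hs, hK⟩ := mem_top_mul_iff.1 hy
        exact mem_top_mul_iff.2 ⟨s, hs.trans (List.suffix_append _ _), hK⟩
      · have ht : M.start ∉ {q | M.evalFrom q y ∈ M.accept} :=
          fun h => hy (mem_top_mul_iff.2 ⟨y, List.suffix_rfl, h⟩)
        rw [append_mem_top_mul_iff M hy, ← lt_lastPosition_iff M w ht]
        exact or_iff_right hy
  · rw [Nat.card_prod, Nat.card_fun, Nat.card_eq_fintype_card, Fintype.card_fin, pow_add, pow_one]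
    gcongr <;> omega

theorem hasPolynomialInvariant_of_mem_LILen {α : Type u} {L : Language α} (hL : L ∈ LILen α) :
    HasPolynomialInvariant L := by
  induction hL using BooleanSubalgebra.closure_bot_sup_induction with
  | mem L hL =>
    rcases hL with h | h
    exacts [hasPolynomialInvariant_of_mem_LI h, hasPolynomialInvariant_of_mem_Len h]
  | bot =>
    refine ⟨PUnit, fun _ => ⟨⟩, ⟨fun _ _ _ => Iff.rfl, fun _ _ _ _ => rfl⟩, 0, fun n =>
      ⟨Set.toFinite _, ?_⟩⟩
    exact (Set.ncard_le_ncard (Set.subset_univ _)).trans (by simp)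
  | sup L _ L' _ h h' => exact h.sup h'
  | compl L _ h => exact h.compl

/-! ### Boolean combinations of left ideals and length languages -/

theorem evalFrom_flatten_replicate {α : Type u} {σ : Type v} (M : DFA α σ) {p : σ} {t : List α}
    (ht : M.evalFrom p t = p) (k : ℕ) : M.evalFrom p (List.replicate k t).flatten = p := by
  induction k with
  | zero => rfl
  | succ k ih => rw [List.replicate_succ, List.flatten_cons, DFA.evalFrom_of_append, ht, ih]

/-- Take the product over all states of one loop length each, and repeat the loops. -/
theorem exists_common_loop_length {α : Type u} {σ : Type v} [Finite σ] (M : DFA α σ) :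
    ∃ N ≠ 0, ∀ p, (∃ t ≠ [], M.evalFrom p t = p) → ∃ t, t.length = N ∧ M.evalFrom p t = p := by
  classical
  have := Fintype.ofFinite σ
  have h : ∀ p, ∃ r ≠ 0, (∃ t ≠ [], M.evalFrom p t = p) →
      ∃ t, t.length = r ∧ M.evalFrom p t = p := by
    intro p
    by_cases hp : ∃ t ≠ [], M.evalFrom p t = p
    · obtain ⟨t, ht, htp⟩ := hp
      exact ⟨t.length, by simpa using ht, fun _ => ⟨t, rfl, htp⟩⟩
    · exact ⟨1, one_ne_zero, fun h => absurd h hp⟩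
  choose r hr hloop using h
  refine ⟨∏ p, r p, Finset.prod_ne_zero_iff.2 fun p _ => hr p, fun p hp => ?_⟩
  obtain ⟨t, ht, htp⟩ := hloop p hp
  obtain ⟨k, hk⟩ := Finset.dvd_prod_of_mem r (Finset.mem_univ p)
  exact ⟨(List.replicate k t).flatten, by simp [hk, ht, mul_comm],
    evalFrom_flatten_replicate M htp k⟩

theorem isRegular_reverse_eval_mem {α : Type u} {σ : Type} [Fintype σ] (M : DFA α σ)
    (A : Set σ) : Language.IsRegular {w : List α | M.eval w.reverse ∈ A} :=
  Language.IsRegular.reverse (L := {w : List α | M.eval w ∈ A})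
    ⟨σ, inferInstance, ⟨M.step, M.start, A⟩, rfl⟩

theorem isRegular_length_cast_eq (α : Type u) (N : ℕ) [NeZero N] (i : ZMod N) :
    Language.IsRegular {w : List α | (w.length : ZMod N) = i} := by
  refine ⟨ZMod N, inferInstance, ⟨fun s _ => s + 1, 0, {i}⟩, ?_⟩
  have heval : ∀ w : List α,
      (⟨fun s _ => s + 1, 0, {i}⟩ : DFA α (ZMod N)).eval w = w.length := by
    intro w
    induction w using List.reverseRecOn with
    | nil => simp
    | append_singleton w a ih => rw [DFA.eval_append_singleton, ih]; simp
  ext w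
  rw [DFA.mem_accepts, heval]
  rfl

/-- If, for the automaton `M` for the reversal of `L`, every accepting state with a loop only
leads, by words of the length of the loop, to accepting states as long as one stays in the same
strongly connected component, then `L` is in the Boolean closure of `LI` and `Len`. -/
theorem mem_LILen_of_wellBehaved {α : Type u} {σ : Type} [Fintype σ] {L : Language α}
    {M : DFA α σ} (hM : M.accepts = L.reverse)
    (hgood : ∀ z u v v' : List α, M.eval z ∈ M.accept → u.length = v.length →
      M.evalFrom (M.eval z) u = M.eval z → M.evalFrom (M.eval z) (v ++ v') = M.eval z →
      M.evalFrom (M.eval z) v ∈ M.accept) :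
    L ∈ LILen α := by
  classical
  obtain ⟨N, hN, hloop⟩ := exists_common_loop_length M
  have : NeZero N := ⟨hN⟩
  have hmem : ∀ w : List α, w ∈ L ↔ M.eval w.reverse ∈ M.accept := by
    intro w
    rw [← DFA.mem_accepts, hM, Language.mem_reverse, List.reverse_reverse]
  let len : ZMod N → Language α := fun i => {w : List α | (w.length : ZMod N) = i}
  let visit : σ → ZMod N → Language α := fun p i =>
    {w : List α | M.eval w.reverse ∈ ({p} : Set σ)} ⊓ len i
  let leave : σ → Language α := fun p =>
    {w : List α | M.eval w.reverse ∈ {q : σ | ∀ v, M.evalFrom q v ≠ p}}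
  have hlen : ∀ i, len i ∈ LILen α := by
    intro i
    refine BooleanSubalgebra.subset_closure (Or.inr ⟨isRegular_length_cast_eq α N i, fun n => ?_⟩)
    by_cases h : (n : ZMod N) = i
    · exact Or.inl fun w hw => by subst hw; exact h
    · exact Or.inr fun w hw => by subst hw; exact h
  have hvisit : ∀ p i, ⊤ * visit p i ∈ LILen α := by
    intro p i
    refine BooleanSubalgebra.subset_closure (Or.inl ⟨_, ?_, rfl⟩)
    exact (isRegular_reverse_eval_mem M {p}).inf (isRegular_length_cast_eq α N i)
  have heval : ∀ a y : List α,
      M.eval (a ++ y).reverse = M.evalFrom (M.eval y.reverse) a.reverse := by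
    intro a y
    rw [List.reverse_append]
    exact M.evalFrom_of_append _ _ _
  have hleave : ∀ p, leave p ∈ LILen α := by
    intro p
    refine BooleanSubalgebra.subset_closure (Or.inl ⟨leave p, isRegular_reverse_eval_mem M _, ?_⟩)
    refine le_antisymm (fun w hw => ⟨[], trivial, w, hw, rfl⟩) ?_
    rintro _ ⟨a, -, y, hy, rfl⟩ v hv
    rw [heval, ← DFA.evalFrom_of_append] at hv
    exact hy _ hv
  -- A word is in `L` iff, while `M` reads it backwards, some accepting `p` is visited at a time
  -- congruent to the full length modulo `N`, and `p` is still reachable at the end. For a word in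
  -- `L`, take the final state itself.
  have hL : L = (Finset.univ.filter fun c : σ × ZMod N => c.1 ∈ M.accept).sup
      fun c => (⊤ * visit c.1 c.2) ⊓ (leave c.1)ᶜ ⊓ len c.2 := by
    refine le_antisymm (fun w hw => ?_) (Finset.sup_le ?_)
    · have hle := Finset.le_sup (f := fun c => (⊤ * visit c.1 c.2) ⊓ (leave c.1)ᶜ ⊓ len c.2)
        (show ((M.eval w.reverse, (w.length : ZMod N)) : σ × ZMod N) ∈
          Finset.univ.filter (fun c : σ × ZMod N => c.1 ∈ M.accept) by simpa using (hmem w).1 hw)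
      refine hle ⟨⟨⟨[], trivial, w, ⟨rfl, rfl⟩, rfl⟩, fun h => h [] rfl⟩, rfl⟩
    · rintro ⟨p, i⟩ hp w ⟨⟨⟨a, -, y, ⟨hy, hyi⟩, rfl⟩, hstay⟩, hi⟩
      have hp : p ∈ M.accept := by simpa using hp
      have hy : M.eval y.reverse = p := hy
      obtain ⟨v', hv'⟩ : ∃ v', M.evalFrom (M.eval (a ++ y).reverse) v' = p := by
        by_contra! h
        exact hstay h
      refine (hmem (a ++ y)).2 ?_
      rw [heval]
      rw [heval, ← DFA.evalFrom_of_append, ← hy] at hv'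
      have hdvd : N ∣ a.length := by
        rw [← CharP.cast_eq_zero_iff (ZMod N)]
        have hi : (((a ++ y).length : ℕ) : ZMod N) = i := hi
        have hyi : (y.length : ZMod N) = i := hyi
        rw [List.length_append, Nat.cast_add, hyi] at hi
        simpa using hi
      -- If `a` is nonempty, `p` lies on a cycle and has a loop of length `N`; repeating it gives a
      -- loop as long as `a`, so `hgood` applies.
      rcases eq_or_ne a [] with rfl | ha
      · simpa [hy] using hp
      obtain ⟨t, ht, htp⟩ := hloop (M.eval y.reverse) ⟨_, by simp [ha], hv'⟩
      refine hgood y.reverse (List.replicate (a.length / N) t).flatten a.reverse v'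
        (hy ▸ hp) ?_ (evalFrom_flatten_replicate M htp _) hv'
      simp [ht, Nat.div_mul_cancel hdvd]
  rw [hL]
  refine Finset.sup_mem (LILen α) BooleanSubalgebra.bot_mem
    (fun x hx y hy => BooleanSubalgebra.sup_mem hx hy) _ _ fun c _ => ?_
  exact BooleanSubalgebra.inf_mem (BooleanSubalgebra.inf_mem (hvisit _ _)
    (BooleanSubalgebra.compl_mem (hleave _))) (hlen _)

theorem randLower_linear_of_notMem_LILen {α : Type u} {L : Language α} (hreg : L.IsRegular)
    (hL : L ∉ LILen α) : RandLower.{u, v} L (fun n => n) := by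
  obtain ⟨σ, _, M, hM⟩ := hreg.reverse
  by_contra h
  refine hL (mem_LILen_of_wellBehaved hM fun z u v v' hz huv hu hv' => ?_)
  by_contra hv
  exact h (randLower_linear hM hz huv hu hv hv')

end SlidingWindow

theorem mainTheorem8 {α : Type u} [Finite α] [Nonempty α] (L : Language α) :
    -- every language other than `∅` and `Σ*`, regular or not, needs logarithmic space
    (L ≠ ⊥ → L ≠ ⊤ → SlidingWindow.RandLower.{u, v} L (fun n => Real.logb 2 n)) ∧
    -- the trichotomy for regular languages, both randomized and deterministic
    (L.IsRegular →
      ((L = ⊥ ∨ L = ⊤) →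
        SlidingWindow.RandUpper L (fun _ => 1) ∧ SlidingWindow.DetUpper L (fun _ => 1)) ∧
      (L ≠ ⊥ → L ≠ ⊤ → L ∈ SlidingWindow.LILen α →
        (SlidingWindow.RandUpper L (fun n => Real.logb 2 n) ∧
          SlidingWindow.RandLower.{u, v} L (fun n => Real.logb 2 n)) ∧
        (SlidingWindow.DetUpper L (fun n => Real.logb 2 n) ∧
          SlidingWindow.DetLower.{u, v} L (fun n => Real.logb 2 n))) ∧
      (L ∉ SlidingWindow.LILen α →
        (SlidingWindow.RandUpper L (fun n => n) ∧
          SlidingWindow.RandLower.{u, v} L (fun n => n)) ∧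
        (SlidingWindow.DetUpper L (fun n => n) ∧
          SlidingWindow.DetLower.{u, v} L (fun n => n)))) := by
  open SlidingWindow in
  refine ⟨randLower_logb, fun hreg => ⟨fun hL => ?_, fun hbot htop hL => ?_, fun hL => ?_⟩⟩
  · exact ⟨(detUpper_const hL).randUpper, detUpper_const hL⟩
  · have hup := (hasPolynomialInvariant_of_mem_LILen hL).detUpper
    have hlow := randLower_logb.{u, v} hbot htop
    exact ⟨⟨hup.randUpper, hlow⟩, hup, hlow.detLower⟩
  · have hup := detUpper_linear L
    have hlow := randLower_linear_of_notMem_LILen.{u, v} hreg hL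
    exact ⟨⟨hup.randUpper, hlow⟩, hup, hlow.detLower⟩
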